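/- Let $p$ be a prime, $0<\rho<1$, $c\in\mathbb R$, $M=\begin{pmatrix}\rho^{-1}&c\\0&\rho^{-1}\end{pmatrix}$, and let $D\subset\mathbb Z^2$ be a set of $p$ vectors. Write $\delta_D=\frac1p\sum_{d\in D}\delta_d$, where $\delta_d$ is the Dirac measure at $d$, and $\widehat{\nu}(\xi)=\int_{\mathbb R^2}e^{-2\pi i\langle\xi,x\rangle}\,d\nu(x)$ for a Borel probability measure $\nu$ on $\mathbb R^2$. Assume that there is a vector $\boldsymbol a=(a_1,a_2)^{\mathsf T}$ with $a_1,a_2\in\{1,\dots,p-1\}$ such that $$\{\xi\in\mathbb R^2:\widehat{\delta_D}(\xi)=0\}=\bigcup_{j=1}^{p-1}\Big(\frac{j\boldsymbol a}{p}+\mathbb Z^2\Big).$$ Then there is a unique Borel probability measure $\mu=\mu_{M,D}$ on $\mathbb R^2$ with $$\mu=\frac1p\sum_{d\in D}\mu\circ\varphi_d^{-1},\qquad \varphi_d(x)=M^{-1}(x+d).$$ Moreover, $L^2(\mu_{M,D})$ contains an infinite orthogonal set of exponential functions (that is, there is an infinite set $\Lambda\subset\mathbb R^2$ such that the functions $x\mapsto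 e^{-2\pi i\langle\lambda,x\rangle}$, $\lambda\in\Lambda$, are pairwise orthogonal in $L^2(\mu_{M,D})$) if and only if there are positive integers $s,t,r$ with $\gcd(s,t)=1$ and $p\mid t$, and a rational number $\kappa$, such that $$\rho^{-1}=\Big(\frac ts\Big)^{1/r}\quad\text{and}\quad c=\kappa\rho^{-1}.$$ -/

import Mathlib

open MeasureTheory Complex
open scoped ENNReal Matrix

noncomputable section

/-- The Euclidean plane, with its Borel sigma-algebra. -/
abbrev Plane : Type := EuclideanSpace ℝ (Fin 2)

/-- An integer vector, regarded as a point of the plane. -/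
def intVec (d : Fin 2 → ℤ) : Plane := WithLp.toLp 2 (fun i => (d i : ℝ))

/-- The contraction `x ↦ M⁻¹ (x + d)` of the iterated function system. -/
def ifsMap (M : Matrix (Fin 2) (Fin 2) ℝ) (d : Fin 2 → ℤ) (x : Plane) : Plane :=
  WithLp.toLp 2 (M⁻¹ *ᵥ (WithLp.ofLp (x + intVec d)))

/-- The self-affine identity `μ = (1 / #D) ∑_{d ∈ D} μ ∘ φ_d⁻¹`. -/
def IsSelfAffineMeasure (M : Matrix (Fin 2) (Fin 2) ℝ) (D : Finset (Fin 2 → ℤ))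
    (μ : Measure Plane) : Prop :=
  μ = (D.card : ℝ≥0∞)⁻¹ • ∑ d ∈ D, μ.map (ifsMap M d)

/-- The exponential function `x ↦ exp (-2πi ⟨ξ, x⟩)`. -/
def expFun (ξ x : Plane) : ℂ :=
  Complex.exp (-2 * Real.pi * I * ((inner ℝ ξ x : ℝ) : ℂ))

/-- The Fourier transform of a measure on the plane. -/
def fourierMeasure (μ : Measure Plane) (ξ : Plane) : ℂ := ∫ x, expFun ξ x ∂μ

/-- The uniform probability measure `δ_D` on a finite set of integer vectors. -/
def digitMeasure (D : Finset (Fin 2 → ℤ)) : Measure Plane :=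
  (D.card : ℝ≥0∞)⁻¹ • ∑ d ∈ D, Measure.dirac (intVec d)

/-- The set of zeros of the Fourier transform of `δ_D`. -/
def digitZeroSet (D : Finset (Fin 2 → ℤ)) : Set Plane :=
  {ξ | fourierMeasure (digitMeasure D) ξ = 0}

theorem continuous_expFun (ξ : Plane) : Continuous (expFun ξ) := by
  unfold expFun
  fun_prop

theorem norm_expFun (ξ x : Plane) : ‖expFun ξ x‖ = 1 := by
  rw [expFun, Complex.norm_exp]
  simp

theorem memLp_expFun (μ : Measure Plane) [IsFiniteMeasure μ] (ξ : Plane) :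
    MemLp (expFun ξ) 2 μ :=
  MemLp.of_bound (continuous_expFun ξ).aestronglyMeasurable 1
    (Filter.Eventually.of_forall fun x => (norm_expFun ξ x).le)

/-- The exponential function with frequency `ξ`, as an element of the Hilbert space `L²(μ)`. -/
def expLp (μ : Measure Plane) [IsFiniteMeasure μ] (ξ : Plane) : Lp ℂ 2 μ :=
  (memLp_expFun μ ξ).toLp (expFun ξ)

/-- `L²(μ)` contains an infinite orthogonal set of exponential functions: there is an infinite set
of frequencies whose exponentials are pairwise orthogonal in `L²(μ)`. -/
def HasInfiniteOrthogonalExponentials (μ : Measure Plane) [IsFiniteMeasure μ] : Prop :=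
  ∃ Λ : Set Plane, Λ.Infinite ∧
    Λ.Pairwise fun ξ η => inner ℂ (expLp μ ξ) (expLp μ η) = 0

end

/-! Put `b = ρ⁻¹` and `κ = c * ρ`, so that `M = b • !![1, κ; 0, 1]`. In Fourier space self-affinity
reads `μ̂(Mᵀξ) = δ̂_D(ξ) μ̂(ξ)`. Since `μ̂` is continuous with `μ̂(0) = 1` and the negative powers
of `Mᵀ` contract to `0`, this gives uniqueness and shows that the zeros of `μ̂` are the images of
the zeros of `δ̂_D` under positive powers of `Mᵀ`. Existence comes from the law of the random series
`∑ M⁻ⁿ dₙ` with independent uniform digits.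

Orthogonality of two exponentials means that `μ̂` vanishes at the difference of their frequencies.
After scaling by `p`, such a difference has coordinates `b ^ n * u` and `b ^ n * (n * κ * u + v)`
with `u`, `v` integers and `p ∤ u`. Three frequencies give a relation `b ^ l * x - b ^ m * y = b ^ k
* z` with `x, y, z` prime to `p`. The key tool is an extension of the `p`-adic valuation to `ℝ`
(`exists_valuationSubring_int`). In an infinite set some relation has exponents that are not all
equal, and then `v b = 1` would leave only finitely many residues (`finite_of_valuation_eq_one`).
With `v b ≠ 1` the ultrametric inequality makes two exponents coincide, and the relation collapses
to two terms, so a power of `b`, and then `κ`, is rational (`exists_rat_of_ne`). The case `v b > 1`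
is again finite (`finite_of_one_lt_valuation`), so `v b < 1` and `p` divides the numerator.

Conversely, if `b ^ r = t / s` and `κ` is rational, an explicit sequence of frequencies works. -/

/-! ### The powers of the adjoint expanding map -/

/-- The `n`-th power of the transpose of `b • !![1, κ; 0, 1]`. -/
noncomputable def shear (b κ : ℝ) (n : ℤ) (ξ : Plane) : Plane :=
  WithLp.toLp 2 ![b ^ n * ξ 0, b ^ n * (n * κ * ξ 0 + ξ 1)]

@[simp] theorem shear_apply_zero (b κ : ℝ) (n : ℤ) (ξ : Plane) :
    shear b κ n ξ 0 = b ^ n * ξ 0 := rfl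

@[simp] theorem shear_apply_one (b κ : ℝ) (n : ℤ) (ξ : Plane) :
    shear b κ n ξ 1 = b ^ n * (n * κ * ξ 0 + ξ 1) := rfl

theorem Plane.ext {ξ η : Plane} (h0 : ξ 0 = η 0) (h1 : ξ 1 = η 1) : ξ = η := by
  ext i
  fin_cases i
  · exact h0
  · exact h1

theorem shear_add {b : ℝ} (hb : b ≠ 0) (κ : ℝ) (m n : ℤ) (ξ : Plane) :
    shear b κ (m + n) ξ = shear b κ m (shear b κ n ξ) := by
  apply Plane.ext
  · simp [zpow_add₀ hb, mul_assoc]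
  · simp [zpow_add₀ hb]
    ring

@[simp] theorem shear_zero_right (b κ : ℝ) (ξ : Plane) : shear b κ 0 ξ = ξ := by
  apply Plane.ext <;> simp

theorem tendsto_shear_neg {b : ℝ} (hb : 1 < b) (κ : ℝ) (ξ : Plane) :
    Filter.Tendsto (fun n : ℕ => shear b κ (-(n : ℤ)) ξ) Filter.atTop (nhds 0) := by
  have hb0 : 0 < b := zero_lt_one.trans hb
  have h1 : Filter.Tendsto (fun n : ℕ => (b⁻¹) ^ n) Filter.atTop (nhds 0) :=
    tendsto_pow_atTop_nhds_zero_of_lt_one (by positivity) (inv_lt_one_of_one_lt₀ hb)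
  have h2 : Filter.Tendsto (fun n : ℕ => (n : ℝ) * (b⁻¹) ^ n) Filter.atTop (nhds 0) :=
    tendsto_self_mul_const_pow_of_lt_one (by positivity) (inv_lt_one_of_one_lt₀ hb)
  have h3 : Filter.Tendsto (fun n : ℕ => WithLp.ofLp (shear b κ (-(n : ℤ)) ξ)) Filter.atTop
      (nhds (WithLp.ofLp (0 : Plane))) := by
    rw [tendsto_pi_nhds]
    intro i
    fin_cases i
    · have := h1.mul_const (ξ 0)
      simpa using this
    · have := (h2.mul_const (-(κ * ξ 0))).add (h1.mul_const (ξ 1))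
      simp only [zero_mul, add_zero] at this
      refine this.congr fun n => ?_
      simp
      ring
  exact ((PiLp.continuous_toLp 2 _).tendsto _).comp h3

/-! ### Fourier transforms -/

theorem fourierMeasure_eq_charFun (μ : Measure Plane) (ξ : Plane) :
    fourierMeasure μ ξ = charFun μ ((-2 * Real.pi) • ξ) := by
  rw [fourierMeasure, charFun_apply]
  congr 1 with x
  rw [expFun, real_inner_comm, real_inner_smul_right, real_inner_comm]
  congr 1
  push_cast
  rw [real_inner_comm]
  ring

theorem fourierMeasure_zero (μ : Measure Plane) [IsProbabilityMeasure μ] :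
    fourierMeasure μ 0 = 1 := by
  simp [fourierMeasure, expFun]

theorem continuous_fourierMeasure (μ : Measure Plane) [IsFiniteMeasure μ] :
    Continuous (fourierMeasure μ) := by
  unfold fourierMeasure
  refine continuous_of_dominated (bound := fun _ => 1)
    (fun ξ => (continuous_expFun ξ).aestronglyMeasurable)
    (fun ξ => Filter.Eventually.of_forall fun x => (norm_expFun ξ x).le)
    (integrable_const 1) (Filter.Eventually.of_forall fun x => ?_)
  unfold expFun
  fun_prop

theorem integrable_expFun (μ : Measure Plane) [IsFiniteMeasure μ] (ξ : Plane) :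
    Integrable (expFun ξ) μ :=
  (memLp_expFun μ ξ).integrable (by norm_num)

theorem measure_eq_of_fourierMeasure_eq {μ ν : Measure Plane} [IsFiniteMeasure μ]
    [IsFiniteMeasure ν] (h : ∀ ξ, fourierMeasure μ ξ = fourierMeasure ν ξ) : μ = ν := by
  apply Measure.ext_of_charFun
  ext ξ
  have h1 := h ((-2 * Real.pi)⁻¹ • ξ)
  have hpi : (-2 * Real.pi) ≠ 0 := by simp [Real.pi_ne_zero]
  rwa [fourierMeasure_eq_charFun, fourierMeasure_eq_charFun, smul_inv_smul₀ hpi] at h1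

theorem expFun_add (ξ x y : Plane) : expFun ξ (x + y) = expFun ξ x * expFun ξ y := by
  rw [expFun, expFun, expFun, ← Complex.exp_add, inner_add_right]
  congr 1
  push_cast
  ring

theorem fourierMeasure_digitMeasure (D : Finset (Fin 2 → ℤ)) (ξ : Plane) :
    fourierMeasure (digitMeasure D) ξ = (D.card : ℂ)⁻¹ * ∑ d ∈ D, expFun ξ (intVec d) := by
  rw [fourierMeasure, digitMeasure, integral_smul_measure, integral_finsetSum_measure]
  · simp
  · exact fun d _ => integrable_expFun _ ξ

/-! ### Orthogonality -/

theorem inner_expLp (μ : Measure Plane) [IsFiniteMeasure μ] (ξ η : Plane) :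
    inner ℂ (expLp μ ξ) (expLp μ η) = fourierMeasure μ (η - ξ) := by
  rw [L2.inner_def, fourierMeasure]
  apply integral_congr_ae
  filter_upwards [(memLp_expFun μ ξ).coeFn_toLp, (memLp_expFun μ η).coeFn_toLp] with x h1 h2
  rw [expLp, expLp, h1, h2, RCLike.inner_apply, expFun, expFun, expFun, ← Complex.exp_conj,
    ← Complex.exp_add, inner_sub_left]
  congr 1
  simp only [map_mul, map_neg, map_ofNat, conj_ofReal, conj_I]
  push_cast
  ring

theorem hasInfiniteOrthogonalExponentials_iff (μ : Measure Plane) [IsFiniteMeasure μ] :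
    HasInfiniteOrthogonalExponentials μ ↔
      ∃ Λ : Set Plane, Λ.Infinite ∧ Λ.Pairwise fun ξ η => fourierMeasure μ (η - ξ) = 0 := by
  simp only [HasInfiniteOrthogonalExponentials, inner_expLp]

/-! ### The self-affine identity in Fourier space -/

theorem expanding_inv {ρ : ℝ} (hρ : ρ ≠ 0) (c : ℝ) :
    (!![ρ⁻¹, c; 0, ρ⁻¹] : Matrix (Fin 2) (Fin 2) ℝ)⁻¹ = !![ρ, -(ρ * (c * ρ)); 0, ρ] := by
  apply Matrix.inv_eq_left_inv
  ext i j
  fin_cases i <;> fin_cases j <;> simp [Matrix.mul_apply, Fin.sum_univ_two, hρ]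
  field_simp
  ring

theorem ifsMap_apply_zero {ρ : ℝ} (hρ : ρ ≠ 0) (c : ℝ) (d : Fin 2 → ℤ) (x : Plane) :
    ifsMap !![ρ⁻¹, c; 0, ρ⁻¹] d x 0 = ρ * ((x 0 + d 0) - c * ρ * (x 1 + d 1)) := by
  rw [ifsMap, expanding_inv hρ]
  simp [Matrix.mulVec, dotProduct, Fin.sum_univ_two, intVec]
  ring

theorem ifsMap_apply_one {ρ : ℝ} (hρ : ρ ≠ 0) (c : ℝ) (d : Fin 2 → ℤ) (x : Plane) :
    ifsMap !![ρ⁻¹, c; 0, ρ⁻¹] d x 1 = ρ * (x 1 + d 1) := by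
  rw [ifsMap, expanding_inv hρ]
  simp [Matrix.mulVec, dotProduct, Fin.sum_univ_two, intVec]

theorem continuous_ifsMap (M : Matrix (Fin 2) (Fin 2) ℝ) (d : Fin 2 → ℤ) :
    Continuous (ifsMap M d) := by
  unfold ifsMap
  fun_prop

/-- This is the adjoint relation `⟨Mᵀξ, M⁻¹(x + d)⟩ = ⟨ξ, x + d⟩`. -/
theorem expFun_shear_ifsMap {ρ : ℝ} (hρ : ρ ≠ 0) (c : ℝ) (d : Fin 2 → ℤ) (ξ x : Plane) :
    expFun (shear ρ⁻¹ (c * ρ) 1 ξ) (ifsMap !![ρ⁻¹, c; 0, ρ⁻¹] d x) =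
      expFun ξ (intVec d) * expFun ξ x := by
  rw [← expFun_add, expFun, expFun]
  congr 3
  simp only [PiLp.inner_apply, Fin.sum_univ_two, ifsMap_apply_zero hρ, ifsMap_apply_one hρ]
  simp [intVec]
  field_simp
  ring

theorem IsSelfAffineMeasure.fourierMeasure_shear {ρ c : ℝ} (hρ : ρ ≠ 0)
    {D : Finset (Fin 2 → ℤ)} {μ : Measure Plane} [IsFiniteMeasure μ]
    (h : IsSelfAffineMeasure !![ρ⁻¹, c; 0, ρ⁻¹] D μ) (ξ : Plane) :
    fourierMeasure μ (shear ρ⁻¹ (c * ρ) 1 ξ) =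
      fourierMeasure (digitMeasure D) ξ * fourierMeasure μ ξ := by
  conv_lhs => rw [fourierMeasure, h]
  rw [integral_smul_measure, integral_finsetSum_measure, fourierMeasure_digitMeasure]
  · simp_rw [integral_map (continuous_ifsMap _ _).aemeasurable
      (continuous_expFun _).aestronglyMeasurable, expFun_shear_ifsMap hρ, integral_const_mul]
    rw [← Finset.sum_mul, ← fourierMeasure]
    simp [mul_assoc]
  · intro d _
    exact integrable_expFun _ _

theorem IsSelfAffineMeasure.fourierMeasure_eq_zero {ρ c : ℝ} (hρ : ρ ≠ 0)
    {D : Finset (Fin 2 → ℤ)} {μ : Measure Plane} [IsFiniteMeasure μ]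
    (h : IsSelfAffineMeasure !![ρ⁻¹, c; 0, ρ⁻¹] D μ) {ξ : Plane} (hξ : ξ ∈ digitZeroSet D) (n : ℕ) :
    fourierMeasure μ (shear ρ⁻¹ (c * ρ) (n + 1 : ℕ) ξ) = 0 := by
  induction n with
  | zero =>
    rw [zero_add, Nat.cast_one, h.fourierMeasure_shear hρ, show fourierMeasure _ ξ = 0 from hξ,
      zero_mul]
  | succ n ih =>
    rw [Nat.cast_succ, add_comm, shear_add (inv_ne_zero hρ), h.fourierMeasure_shear hρ, ih,
      mul_zero]

theorem shear_neg_succ {b : ℝ} (hb : b ≠ 0) (κ : ℝ) (n : ℕ) (ξ : Plane) :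
    shear b κ 1 (shear b κ (-((n + 1 : ℕ) : ℤ)) ξ) = shear b κ (-(n : ℤ)) ξ := by
  rw [← shear_add hb]
  congr 1
  push_cast
  ring

/-- If no backward iterate of `ξ` were a zero of `δ̂_D`, then `μ̂` would vanish along the whole
backward orbit, which tends to `0`, where `μ̂ = 1`. -/
theorem IsSelfAffineMeasure.exists_mem_digitZeroSet {ρ c : ℝ} (hρ0 : 0 < ρ) (hρ1 : ρ < 1)
    {D : Finset (Fin 2 → ℤ)} {μ : Measure Plane} [IsProbabilityMeasure μ]
    (h : IsSelfAffineMeasure !![ρ⁻¹, c; 0, ρ⁻¹] D μ) {ξ : Plane} (hξ : fourierMeasure μ ξ = 0) :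
    ∃ n : ℕ, ∃ ζ ∈ digitZeroSet D, ξ = shear ρ⁻¹ (c * ρ) n ζ := by
  by_contra! hcon
  have hb : ρ⁻¹ ≠ 0 := inv_ne_zero hρ0.ne'
  have hz : ∀ n : ℕ, fourierMeasure μ (shear ρ⁻¹ (c * ρ) (-(n : ℤ)) ξ) = 0 := by
    intro n
    induction n with
    | zero => simpa using hξ
    | succ n ih =>
      rw [← shear_neg_succ hb, h.fourierMeasure_shear hρ0.ne'] at ih
      refine (mul_eq_zero.mp ih).resolve_left fun h0 => hcon (n + 1) _ h0 ?_
      rw [← shear_add hb, add_neg_cancel, shear_zero_right]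
  have hlim := ((continuous_fourierMeasure μ).tendsto 0).comp
    (tendsto_shear_neg ((one_lt_inv₀ hρ0).mpr hρ1) (c * ρ) ξ)
  rw [fourierMeasure_zero] at hlim
  refine zero_ne_one (tendsto_nhds_unique (hlim.congr fun n => hz n) tendsto_const_nhds).symm

theorem norm_fourierMeasure_le_one (μ : Measure Plane) [IsProbabilityMeasure μ] (ξ : Plane) :
    ‖fourierMeasure μ ξ‖ ≤ 1 := by
  rw [fourierMeasure_eq_charFun]
  exact norm_charFun_le_one _

theorem isProbabilityMeasure_digitMeasure {D : Finset (Fin 2 → ℤ)} (hD : D.Nonempty) :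
    IsProbabilityMeasure (digitMeasure D) := by
  constructor
  simp [digitMeasure, ENNReal.inv_mul_cancel, hD.ne_empty]

/-- As `|δ̂_D| ≤ 1`, the gap between the two transforms does not decrease along the backward orbit
of `ξ`, yet it tends to the gap at `0`, which is `1 - 1`. -/
theorem IsSelfAffineMeasure.unique {ρ c : ℝ} (hρ0 : 0 < ρ) (hρ1 : ρ < 1)
    {D : Finset (Fin 2 → ℤ)} (hD : D.Nonempty) {μ ν : Measure Plane} [IsProbabilityMeasure μ]
    [IsProbabilityMeasure ν] (hμ : IsSelfAffineMeasure !![ρ⁻¹, c; 0, ρ⁻¹] D μ)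
    (hν : IsSelfAffineMeasure !![ρ⁻¹, c; 0, ρ⁻¹] D ν) : μ = ν := by
  apply measure_eq_of_fourierMeasure_eq
  intro ξ
  have := isProbabilityMeasure_digitMeasure hD
  have hb : ρ⁻¹ ≠ 0 := inv_ne_zero hρ0.ne'
  have hle : ∀ n : ℕ, ‖fourierMeasure μ ξ - fourierMeasure ν ξ‖ ≤
      ‖fourierMeasure μ (shear ρ⁻¹ (c * ρ) (-(n : ℤ)) ξ) -
        fourierMeasure ν (shear ρ⁻¹ (c * ρ) (-(n : ℤ)) ξ)‖ := by
    intro n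
    induction n with
    | zero => simp
    | succ n ih =>
      refine ih.trans ?_
      rw [← shear_neg_succ hb, hμ.fourierMeasure_shear hρ0.ne', hν.fourierMeasure_shear hρ0.ne',
        ← mul_sub, norm_mul]
      exact mul_le_of_le_one_left (norm_nonneg _) (norm_fourierMeasure_le_one _ _)
  have hlim : Filter.Tendsto (fun n : ℕ =>
      ‖fourierMeasure μ (shear ρ⁻¹ (c * ρ) (-(n : ℤ)) ξ) -
        fourierMeasure ν (shear ρ⁻¹ (c * ρ) (-(n : ℤ)) ξ)‖) Filter.atTop (nhds 0) := by
    have hcont := (((continuous_fourierMeasure μ).sub (continuous_fourierMeasure ν)).norm.tendsto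
      0).comp (tendsto_shear_neg ((one_lt_inv₀ hρ0).mpr hρ1) (c * ρ) ξ)
    simpa [fourierMeasure_zero, Function.comp_def] using hcont
  rw [← sub_eq_zero, ← norm_le_zero_iff]
  exact ge_of_tendsto' hlim hle

/-! ### Existence of the self-affine measure -/

/-- The uniform probability measure on a finite type. -/
noncomputable def uniformMeasure (E : Type*) [Fintype E] [MeasurableSpace E] : Measure E :=
  (Fintype.card E : ℝ≥0∞)⁻¹ • ∑ d : E, Measure.dirac d

instance isProbabilityMeasure_uniformMeasure (E : Type*) [Fintype E] [Nonempty E]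
    [MeasurableSpace E] : IsProbabilityMeasure (uniformMeasure E) := by
  constructor
  simp [uniformMeasure, ENNReal.inv_mul_cancel]

/-- Prepend a term to a sequence. -/
def seqCons {E : Type*} (d : E) (ω : ℕ → E) : ℕ → E
  | 0 => d
  | n + 1 => ω n

theorem measurable_seqCons {E : Type*} [MeasurableSpace E] (d : E) :
    Measurable (seqCons d : (ℕ → E) → ℕ → E) := by
  rw [measurable_pi_iff]
  rintro (_ | n)
  · exact measurable_const
  · exact measurable_pi_apply n

/-- Conditioning on the first term of an i.i.d. sequence. Pushed forward by `digitSeries`, this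
becomes the self-affine identity. -/
theorem infinitePi_uniformMeasure_eq (E : Type*) [Fintype E] [Nonempty E] [MeasurableSpace E] :
    Measure.infinitePi (fun _ : ℕ => uniformMeasure E) =
      (Fintype.card E : ℝ≥0∞)⁻¹ •
        ∑ d : E, (Measure.infinitePi (fun _ : ℕ => uniformMeasure E)).map (seqCons d) := by
  classical
  symm
  apply Measure.eq_infinitePi
  intro s t ht
  -- Cylinders are rewritten over an initial segment, with trivial constraints added, so that index
  -- `0` is always present and can be split off.
  obtain ⟨n, hn⟩ : ∃ n, s ⊆ Finset.range (n + 1) :=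
    ⟨s.sup id, fun i hi => by
      have := Finset.le_sup (f := id) hi
      simp only [id] at this
      simpa using Nat.lt_succ_of_le this⟩
  let t' : ℕ → Set E := fun i => if i ∈ s then t i else Set.univ
  have ht' : ∀ i, MeasurableSet (t' i) := fun i => by
    by_cases hi : i ∈ s <;> simp [t', hi, ht]
  have hpi : Set.pi (s : Set ℕ) t = Set.pi (Finset.range (n + 1) : Set ℕ) t' := by
    ext ω
    simp only [Set.mem_pi, Finset.mem_coe]
    refine ⟨fun h i _ => ?_, fun h i hi => ?_⟩
    · by_cases hi : i ∈ s
      · simpa [t', hi] using h i hi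
      · simp [t', hi]
    · simpa [t', hi] using h i (hn hi)
  have hprod : ∏ i ∈ s, uniformMeasure E (t i) =
      ∏ i ∈ Finset.range (n + 1), uniformMeasure E (t' i) := by
    rw [← Finset.prod_subset hn]
    · exact Finset.prod_congr rfl fun i hi => by simp [t', hi]
    · intro i _ hi
      simp [t', hi]
  have hmap : ∀ d : E, (Measure.infinitePi (fun _ : ℕ => uniformMeasure E)).map (seqCons d)
      (Set.pi (Finset.range (n + 1) : Set ℕ) t') =
      (t' 0).indicator 1 d * ∏ i ∈ Finset.range n, uniformMeasure E (t' (i + 1)) := by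
    intro d
    rw [Measure.map_apply (measurable_seqCons d)
      (MeasurableSet.pi (Finset.countable_toSet _) fun i _ => ht' i)]
    by_cases hd : d ∈ t' 0
    · rw [Set.indicator_of_mem hd, Pi.one_apply, one_mul,
        ← Measure.infinitePi_pi _ (s := Finset.range n) (t := fun i => t' (i + 1))
          fun i _ => ht' (i + 1)]
      congr 1
      ext ω
      simp only [Set.mem_preimage, Set.mem_pi, Finset.mem_coe, Finset.mem_range]
      refine ⟨fun h i hi => h (i + 1) (by omega), fun h i hi => ?_⟩
      cases i with
      | zero => exact hd
      | succ i => exact h i (by omega)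
    · rw [Set.indicator_of_notMem hd, zero_mul]
      convert measure_empty
      · ext ω
        simp only [Set.mem_preimage, Set.mem_pi, Finset.mem_coe, Finset.mem_range,
          Set.mem_empty_iff_false, iff_false]
        exact fun h => hd (h 0 n.succ_pos)
      · infer_instance
  rw [hpi, hprod, Finset.prod_range_succ', Measure.smul_apply, Measure.finsetSum_apply,
    Finset.sum_congr rfl fun d _ => hmap d, ← Finset.sum_mul, smul_eq_mul, ← mul_assoc, mul_comm]
  congr 1
  rw [uniformMeasure, Measure.smul_apply, Measure.finsetSum_apply, smul_eq_mul]
  congr 1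
  exact Finset.sum_congr rfl fun d _ => (Measure.dirac_apply' d (ht' 0)).symm

section

variable {D : Finset (Fin 2 → ℤ)}

theorem exists_digit_bound (D : Finset (Fin 2 → ℤ)) :
    ∃ B : ℝ, ∀ d : D, ∀ i, |(d.1 i : ℝ)| ≤ B := by
  obtain ⟨B, hB⟩ := ((Set.toFinite (Set.univ : Set (D × Fin 2))).image
    fun x => |(x.1.1 x.2 : ℝ)|).bddAbove
  exact ⟨B, fun d i => hB ⟨(d, i), Set.mem_univ _, rfl⟩⟩

theorem summable_digit_one {ρ : ℝ} (hρ0 : 0 < ρ) (hρ1 : ρ < 1) (ω : ℕ → D) (i : Fin 2) :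
    Summable fun n => ρ ^ (n + 1) * ((ω n).1 i : ℝ) := by
  obtain ⟨B, hB⟩ := exists_digit_bound D
  have h1 : Summable fun n : ℕ => ρ ^ (n + 1) * B :=
    ((summable_nat_add_iff 1).mpr (summable_geometric_of_lt_one hρ0.le hρ1)).mul_right B
  refine Summable.of_norm_bounded h1 fun n => ?_
  rw [norm_mul, norm_pow, Real.norm_of_nonneg hρ0.le, Real.norm_eq_abs]
  exact mul_le_mul_of_nonneg_left (hB _ _) (pow_nonneg hρ0.le _)

theorem summable_digit_mul {ρ : ℝ} (hρ0 : 0 < ρ) (hρ1 : ρ < 1) (ω : ℕ → D) (i : Fin 2) :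
    Summable fun n : ℕ => ((n : ℝ) + 1) * ρ ^ (n + 1) * ((ω n).1 i : ℝ) := by
  obtain ⟨B, hB⟩ := exists_digit_bound D
  have h0 : Summable fun n : ℕ => (n : ℝ) ^ 1 * ρ ^ n :=
    summable_pow_mul_geometric_of_norm_lt_one 1 (by rwa [Real.norm_of_nonneg hρ0.le])
  have h1 := ((summable_nat_add_iff 1).mpr h0).mul_right B
  refine Summable.of_norm_bounded h1 fun n => ?_
  rw [norm_mul, norm_mul, norm_pow, Real.norm_of_nonneg hρ0.le, Real.norm_of_nonneg (by positivity),
    Real.norm_eq_abs]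
  push_cast
  rw [pow_one]
  exact mul_le_mul_of_nonneg_left (hB _ _) (by positivity)

theorem summable_digit_zero {ρ : ℝ} (hρ0 : 0 < ρ) (hρ1 : ρ < 1) (κ : ℝ) (ω : ℕ → D) :
    Summable fun n : ℕ => ρ ^ (n + 1) * (((ω n).1 0 : ℝ) - (n + 1) * κ * (ω n).1 1) := by
  refine ((summable_digit_one hρ0 hρ1 ω 0).sub
    ((summable_digit_mul hρ0 hρ1 ω 1).mul_left κ)).congr fun n => ?_
  ring

/-- The sum of the series `∑ M⁻ⁿ dₙ`. -/
noncomputable def digitSeries (ρ κ : ℝ) (ω : ℕ → D) : Plane :=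
  WithLp.toLp 2 ![∑' n : ℕ, ρ ^ (n + 1) * (((ω n).1 0 : ℝ) - (n + 1) * κ * (ω n).1 1),
    ∑' n : ℕ, ρ ^ (n + 1) * ((ω n).1 1 : ℝ)]

theorem measurable_tsum_of_summable {Ω : Type*} [MeasurableSpace Ω] {f : ℕ → Ω → ℝ}
    (hf : ∀ n, Measurable (f n)) (hs : ∀ ω, Summable fun n => f n ω) :
    Measurable fun ω => ∑' n, f n ω :=
  measurable_of_tendsto_metrizable
    (f := fun N ω => ∑ n ∈ Finset.range N, f n ω)
    (fun _ => Finset.measurable_fun_sum _ fun n _ => hf n)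
    (tendsto_pi_nhds.mpr fun ω => (hs ω).hasSum.tendsto_sum_nat)

theorem measurable_digitSeries {ρ : ℝ} (hρ0 : 0 < ρ) (hρ1 : ρ < 1) (κ : ℝ) :
    Measurable (digitSeries ρ κ : (ℕ → D) → Plane) := by
  have hdig : ∀ n i, Measurable fun ω : ℕ → D => ((ω n).1 i : ℝ) := fun n i =>
    (measurable_of_finite (fun d : D => ((d.1 i : ℤ) : ℝ))).comp (measurable_pi_apply n)
  refine (WithLp.measurable_toLp 2 (Fin 2 → ℝ)).comp (measurable_pi_iff.mpr fun i => ?_)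
  fin_cases i
  · exact measurable_tsum_of_summable
      (fun n => ((hdig n 0).sub ((hdig n 1).const_mul _)).const_mul _)
      (summable_digit_zero hρ0 hρ1 κ)
  · exact measurable_tsum_of_summable (fun n => (hdig n 1).const_mul _)
      (fun ω => summable_digit_one hρ0 hρ1 ω 1)

theorem digitSeries_seqCons {ρ : ℝ} (hρ0 : 0 < ρ) (hρ1 : ρ < 1) (c : ℝ) (d : D) (ω : ℕ → D) :
    digitSeries ρ (c * ρ) (seqCons d ω) =
      ifsMap !![ρ⁻¹, c; 0, ρ⁻¹] d.1 (digitSeries ρ (c * ρ) ω) := by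
  apply Plane.ext
  · rw [ifsMap_apply_zero hρ0.ne']
    simp only [digitSeries, PiLp.toLp_apply, Matrix.cons_val_zero, Matrix.cons_val_one]
    rw [(summable_digit_zero hρ0 hρ1 _ _).tsum_eq_zero_add]
    have h0 := (summable_digit_zero hρ0 hρ1 (c * ρ) ω).mul_left ρ
    have h1 := (summable_digit_one hρ0 hρ1 ω 1).mul_left (ρ * (c * ρ))
    have h2 : ∀ n : ℕ, ρ ^ (n + 1 + 1) * (((seqCons d ω (n + 1)).1 0 : ℝ) -
        (((n + 1 : ℕ) : ℝ) + 1) * (c * ρ) * (seqCons d ω (n + 1)).1 1) =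
        ρ * (ρ ^ (n + 1) * (((ω n).1 0 : ℝ) - (n + 1) * (c * ρ) * (ω n).1 1)) -
          ρ * (c * ρ) * (ρ ^ (n + 1) * ((ω n).1 1 : ℝ)) := by
      intro n
      simp only [seqCons]
      push_cast
      ring
    rw [tsum_congr h2, h0.tsum_sub h1, tsum_mul_left, tsum_mul_left]
    simp only [seqCons]
    push_cast
    ring
  · rw [ifsMap_apply_one hρ0.ne']
    simp only [digitSeries, PiLp.toLp_apply, Matrix.cons_val_one, Matrix.cons_val_zero]
    rw [(summable_digit_one hρ0 hρ1 _ _).tsum_eq_zero_add, mul_add, add_comm, ← tsum_mul_left]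
    congr 1
    · exact tsum_congr fun n => by simp only [seqCons]; ring
    · simp [seqCons]

theorem exists_isSelfAffineMeasure {ρ : ℝ} (hρ0 : 0 < ρ) (hρ1 : ρ < 1) (c : ℝ)
    (hD : D.Nonempty) :
    ∃ μ : ProbabilityMeasure Plane,
      IsSelfAffineMeasure !![ρ⁻¹, c; 0, ρ⁻¹] D (μ : Measure Plane) := by
  have : Nonempty D := hD.to_subtype
  have hX := measurable_digitSeries (D := D) hρ0 hρ1 (c * ρ)
  let P := Measure.infinitePi (fun _ : ℕ => uniformMeasure D)
  refine ⟨⟨P.map (digitSeries ρ (c * ρ)), Measure.isProbabilityMeasure_map hX.aemeasurable⟩, ?_⟩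
  change P.map _ = _
  conv_lhs => rw [show P = _ from infinitePi_uniformMeasure_eq D]
  rw [Measure.map_smul, ← Measure.mapₗ_apply_of_measurable hX, map_sum, Fintype.card_coe,
    ← Finset.sum_coe_sort D]
  congr 1
  refine Finset.sum_congr rfl fun d _ => ?_
  rw [Measure.mapₗ_apply_of_measurable hX, Measure.map_map hX (measurable_seqCons d)]
  change _ = Measure.map _ (P.map _)
  rw [Measure.map_map (continuous_ifsMap _ _).measurable hX]
  congr 1
  funext ω
  exact digitSeries_seqCons hρ0 hρ1 c d ω

end

/-! ### A valuation of the reals extending the `p`-adic one -/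

/-- The ideal `(p)` of `ℤ ⊂ ℝ` is proper, so some valuation ring of `ℝ` contains `ℤ` and has `p`
among its nonunits. Bézout then makes every integer prime to `p` a unit. -/
theorem exists_valuationSubring_int (p : ℕ) (hp : p.Prime) :
    ∃ V : ValuationSubring ℝ, (∀ z : ℤ, V.valuation (z : ℝ) ≤ 1) ∧
      ∀ z : ℤ, V.valuation (z : ℝ) = 1 ↔ ¬ (p : ℤ) ∣ z := by
  let A : Subring ℝ := (Int.castRingHom ℝ).range
  let f : ℤ →+* A := (Int.castRingHom ℝ).rangeRestrict
  have hf : Function.Surjective f := (Int.castRingHom ℝ).rangeRestrict_surjective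
  have hfi : Function.Injective f := by
    intro x y h
    have := congrArg Subtype.val h
    exact Int.cast_injective (α := ℝ) this
  let I : Ideal A := Ideal.span {f p}
  have hI : I ≠ ⊤ := by
    intro h
    rw [Ideal.span_singleton_eq_top, isUnit_iff_exists_inv] at h
    obtain ⟨y, hy⟩ := h
    obtain ⟨z, rfl⟩ := hf y
    rw [← map_mul, ← map_one f] at hy
    have h1 := hfi hy
    have h2 : (p : ℤ) ∣ 1 := ⟨z, h1.symm⟩
    exact hp.one_lt.ne' (by exact_mod_cast Int.eq_one_of_dvd_one (by positivity) h2)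
  obtain ⟨V, hAV, hV⟩ := Ideal.image_subset_nonunits_valuationSubring I hI
  have hle : ∀ z : ℤ, V.valuation (z : ℝ) ≤ 1 := fun z =>
    (V.valuation_le_one_iff _).mpr (hAV ⟨z, rfl⟩)
  have hpV : V.valuation (p : ℝ) < 1 := by
    rw [← V.mem_nonunits_iff]
    exact hV ⟨f p, Ideal.mem_span_singleton_self _, by simp [f]⟩
  refine ⟨V, hle, fun z => ⟨?_, fun hz => le_antisymm (hle z) ?_⟩⟩
  · rintro h ⟨w, rfl⟩
    rw [Int.cast_mul, map_mul, Int.cast_natCast] at h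
    exact ((mul_le_of_le_one_right' (hle w)).trans_lt hpV).ne h
  · obtain ⟨x, y, hxy⟩ := (Int.isCoprime_iff_gcd_eq_one.mpr
      ((Int.prime_iff_natAbs_prime.mpr (by simpa using hp)).coprime_iff_not_dvd.mpr hz |>
        Int.isCoprime_iff_gcd_eq_one.mp))
    by_contra! hlt
    have h1 : V.valuation ((x : ℝ) * (p : ℝ) + (y : ℝ) * (z : ℝ)) < 1 := by
      apply Valuation.map_add_lt
      · rw [map_mul]
        exact (mul_le_of_le_one_left' (hle x)).trans_lt hpV
      · rw [map_mul]
        exact (mul_le_of_le_one_left' (hle y)).trans_lt hlt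
    have h2 : (x : ℝ) * (p : ℝ) + (y : ℝ) * (z : ℝ) = 1 := by exact_mod_cast hxy
    rw [h2, map_one] at h1
    exact lt_irrefl _ h1

section

variable {V : ValuationSubring ℝ} {p : ℕ} {b : ℝ}

theorem valuation_pow_mul_unit (hV : ∀ z : ℤ, V.valuation (z : ℝ) = 1 ↔ ¬ (p : ℤ) ∣ z) (n : ℕ)
    {z : ℤ} (hz : ¬ (p : ℤ) ∣ z) : V.valuation (b ^ n * z) = V.valuation b ^ n := by
  rw [map_mul, map_pow, (hV z).mpr hz, mul_one]

/-- In a difference of two elements of different valuations, the larger valuation survives. -/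
theorem valuation_pow_of_sub_eq (hV : ∀ z : ℤ, V.valuation (z : ℝ) = 1 ↔ ¬ (p : ℤ) ∣ z)
    {k m n : ℕ} {x y z : ℤ} (hx : ¬ (p : ℤ) ∣ x) (hy : ¬ (p : ℤ) ∣ y) (hz : ¬ (p : ℤ) ∣ z)
    (h : b ^ m * (x : ℝ) - b ^ n * y = b ^ k * z) (hmn : V.valuation b ^ m ≠ V.valuation b ^ n) :
    V.valuation b ^ k = max (V.valuation b ^ m) (V.valuation b ^ n) := by
  rw [← valuation_pow_mul_unit hV k hz, ← h, sub_eq_add_neg, Valuation.map_add_of_distinct_val,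
    Valuation.map_neg, valuation_pow_mul_unit hV m hx, valuation_pow_mul_unit hV n hy]
  rwa [Valuation.map_neg, valuation_pow_mul_unit hV m hx, valuation_pow_mul_unit hV n hy]

end

/-! ### Sets of reals whose differences have the form `b ^ n * z` with `z` prime to `p` -/

/-- The `z x` distinct modulo a fixed integer `N` force finiteness. -/
theorem finite_of_injOn_intCast {α : Type*} {S : Set α} {f : α → ℤ} {N : ℕ} (hN : N ≠ 0)
    (h : ∀ x ∈ S, ∀ y ∈ S, x ≠ y → ¬ (N : ℤ) ∣ f x - f y) : S.Finite := by
  have : NeZero N := ⟨hN⟩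
  refine Set.Finite.of_injOn (f := fun x => (f x : ZMod N)) (t := Set.univ)
    (fun _ _ => Set.mem_univ _) ?_ Set.finite_univ
  intro x hx y hy hxy
  by_contra hne
  apply h x hx y hy hne
  rw [← ZMod.intCast_zmod_eq_zero_iff_dvd, Int.cast_sub]
  exact sub_eq_zero.mpr hxy

open Polynomial in
/-- If `v b = 1` then the residue of `b` is algebraic over the prime field as soon as one
nondegenerate relation is available, and then only finitely many residues occur. -/
theorem finite_of_valuation_eq_one {p : ℕ} (hp : p.Prime) {V : ValuationSubring ℝ} {b : ℝ}
    (hV : ∀ z : ℤ, V.valuation (z : ℝ) = 1 ↔ ¬ (p : ℤ) ∣ z) (hb : V.valuation b = 1)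
    {α : Type*} {S : Set α} {f : α → ℝ} {n : α → ℕ} {z : α → ℤ}
    (hf : ∀ x ∈ S, f x = b ^ n x * z x)
    (hS : ∀ x ∈ S, ∀ y ∈ S, x ≠ y → V.valuation (f x - f y) = 1)
    {P : ℤ[X]} (hP : P.map (Int.castRingHom (ZMod p)) ≠ 0) (hPb : aeval b P = 0) : S.Finite := by
  have : Fact p.Prime := ⟨hp⟩
  let k := IsLocalRing.ResidueField V
  let π : V →+* k := IsLocalRing.residue V
  let β : V := ⟨b, (V.valuation_le_one_iff b).mp hb.le⟩
  have hpk : (p : k) = 0 := by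
    have h1 : ((p : ℕ) : k) = π (p : V) := by simp
    rw [h1, IsLocalRing.residue_eq_zero_iff, V.valuation_lt_one_iff]
    refine lt_of_le_of_ne (V.valuation_le_one _) fun h => ?_
    exact (hV p).mp (by simpa using h) dvd_rfl
  have : CharP k p := (CharP.charP_iff_prime_eq_zero hp).mpr hpk
  let : Algebra (ZMod p) k := ZMod.algebra k p
  have hβ : aeval β P = 0 := by
    apply Subtype.val_injective
    change V.subtype (aeval β P) = 0
    rw [aeval_def, hom_eval₂]
    rw [aeval_def] at hPb
    rw [RingHom.ext_int (V.subtype.comp (algebraMap ℤ V)) (algebraMap ℤ ℝ)]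
    exact hPb
  have hπβ : aeval (π β) (P.map (Int.castRingHom (ZMod p))) = 0 := by
    rw [aeval_def, eval₂_map]
    have h1 := congrArg π hβ
    rw [aeval_def, hom_eval₂, map_zero] at h1
    rw [RingHom.ext_int ((algebraMap (ZMod p) k).comp (Int.castRingHom (ZMod p)))
      (π.comp (algebraMap ℤ V))]
    exact h1
  have hint : IsIntegral (ZMod p) (π β) := isAlgebraic_iff_isIntegral.mp ⟨_, hP, hπβ⟩
  have : FiniteDimensional (ZMod p) (IntermediateField.adjoin (ZMod p) {π β}) :=
    IntermediateField.adjoin.finiteDimensional hint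
  have : Finite (IntermediateField.adjoin (ZMod p) {π β}) := Module.finite_of_finite (ZMod p)
  refine Set.Finite.of_injOn (f := fun x => π (β ^ n x * (z x : V)))
    -- All residues lie in the finite field generated by the residue of `b`, and they are distinct
    -- because the differences are units.
    (t := (IntermediateField.adjoin (ZMod p) {π β} : Set k)) (fun x _ => ?_) ?_ (Set.toFinite _)
  · simp only [map_mul, map_pow, map_intCast]
    exact mul_mem (pow_mem (IntermediateField.mem_adjoin_simple_self _ _) _) (intCast_mem _ _)
  · intro x hx y hy hxy
    by_contra hne
    have h1 : β ^ n x * (z x : V) - β ^ n y * (z y : V) ∈ IsLocalRing.maximalIdeal V := by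
      rw [← IsLocalRing.residue_eq_zero_iff, map_sub]
      exact sub_eq_zero.mpr hxy
    rw [V.valuation_lt_one_iff] at h1
    refine h1.ne ?_
    rw [← hS x hx y hy hne, hf x hx, hf y hy]
    simp [β]

-- Of three exponents not all equal, one differs from the other two, and its coefficient survives.
open Polynomial in
theorem trinomial_ne_zero {F : Type*} [Field F] {i j k : ℕ} {a b c : F} (ha : a ≠ 0) (hb : b ≠ 0)
    (hc : c ≠ 0) (h : ¬ (i = j ∧ i = k)) : C a * X ^ i - C b * X ^ j - C c * X ^ k ≠ 0 := by
  intro h0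
  have hco : ∀ m, (C a * X ^ i - C b * X ^ j - C c * X ^ k : F[X]).coeff m = 0 := by simp [h0]
  simp only [coeff_sub, coeff_C_mul_X_pow] at hco
  have hi := hco i
  have hj := hco j
  have hk := hco k
  by_cases hij : i = j
  · have hik : i ≠ k := fun hik => h ⟨hij, hik⟩
    subst hij
    simp [hik.symm, hc] at hk
  · by_cases hik : i = k
    · subst hik
      simp [Ne.symm hij, hb] at hj
    · simp [hij, hik, ha] at hi

/-- The first equation gives `b ^ (n - m) = x₁ / x₂`. Substituted in the second, it leaves `(n - m)
* κ * x₁ = y₁ - b ^ (n - m) * y₂`, linear in `κ`. -/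
theorem exists_rat_of_lt {b κ : ℝ} (hb : b ≠ 0) {m n : ℕ} (hmn : m < n) {x₁ x₂ y₁ y₂ : ℤ}
    (hx : x₂ ≠ 0) (h₁ : b ^ m * (x₁ : ℝ) = b ^ n * x₂)
    (h₂ : b ^ m * (m * κ * x₁ + y₁) = b ^ n * (n * κ * x₂ + y₂)) :
    (∃ r : ℕ, 0 < r ∧ ∃ q : ℚ, b ^ r = q) ∧ ∃ q : ℚ, κ = q := by
  obtain ⟨d, rfl⟩ := Nat.exists_eq_add_of_lt hmn
  have hx' : (x₂ : ℝ) ≠ 0 := by exact_mod_cast hx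
  rw [add_assoc, pow_add, mul_assoc, mul_right_inj' (pow_ne_zero _ hb)] at h₁
  rw [add_assoc, pow_add, mul_assoc (b ^ m), mul_right_inj' (pow_ne_zero _ hb)] at h₂
  have hq : b ^ (d + 1) = (x₁ : ℝ) / x₂ := by
    rw [h₁, mul_div_assoc, div_self hx', mul_one]
  have hx₁ : (x₁ : ℝ) ≠ 0 := h₁ ▸ mul_ne_zero (pow_ne_zero _ hb) hx'
  refine ⟨⟨d + 1, d.succ_pos, (x₁ : ℚ) / x₂, by push_cast; exact hq⟩,
    ((y₁ : ℚ) - x₁ / x₂ * y₂) / ((d + 1) * x₁), ?_⟩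
  have hd : (d : ℝ) + 1 ≠ 0 := by positivity
  push_cast at h₂ ⊢
  rw [eq_div_iff (mul_ne_zero hd hx₁), ← hq]
  linear_combination ((m + d + 1 : ℝ) * κ) * h₁ - h₂

theorem exists_rat_of_ne {b κ : ℝ} (hb : b ≠ 0) {m n : ℕ} (hmn : m ≠ n) {x₁ x₂ y₁ y₂ : ℤ}
    (hx : x₂ ≠ 0) (h₁ : b ^ m * (x₁ : ℝ) = b ^ n * x₂)
    (h₂ : b ^ m * (m * κ * x₁ + y₁) = b ^ n * (n * κ * x₂ + y₂)) :
    (∃ r : ℕ, 0 < r ∧ ∃ q : ℚ, b ^ r = q) ∧ ∃ q : ℚ, κ = q := by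
  rcases hmn.lt_or_gt with h | h
  · exact exists_rat_of_lt hb h hx h₁ h₂
  · refine exists_rat_of_lt hb h ?_ h₁.symm h₂.symm
    rintro rfl
    have : b ^ n * (x₂ : ℝ) ≠ 0 := mul_ne_zero (pow_ne_zero _ hb) (by exact_mod_cast hx)
    exact this (by rw [← h₁]; simp)

/-- If `p` divided the denominator of a power of `b`, only finitely many mutual differences of the
form `b ^ n * z` would be possible. -/
theorem finite_of_one_lt_valuation {p : ℕ} (hp : p.Prime) {V : ValuationSubring ℝ} {b : ℝ}
    (hb : 1 < b) (hle : ∀ z : ℤ, V.valuation (z : ℝ) ≤ 1)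
    (hV : ∀ z : ℤ, V.valuation (z : ℝ) = 1 ↔ ¬ (p : ℤ) ∣ z) (hvb : 1 < V.valuation b)
    {r : ℕ} (hr : 0 < r) {q : ℚ} (hq : b ^ r = q) {α : Type*} {S : Set α} {n : α → ℕ} {z : α → ℤ}
    (hz : ∀ x ∈ S, ¬ (p : ℤ) ∣ z x)
    (hS : ∀ x ∈ S, ∀ y ∈ S, x ≠ y → ∃ N : ℕ, ∃ U : ℤ, ¬ (p : ℤ) ∣ U ∧
      b ^ n x * (z x : ℝ) - b ^ n y * z y = b ^ N * U) : S.Finite := by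
  have hb0 : 0 < b := zero_lt_one.trans hb
  have hmono := pow_right_strictMono₀ hvb
  have hlevel : ∀ m, {x ∈ S | n x = m}.Finite := by
    intro m
    -- The modulus only has to exceed every `q.den ^ e` with `e ≤ m`: a congruence between two `z`
    -- would force it to divide such a power.
    refine finite_of_injOn_intCast (f := z) (N := p ^ (q.den ^ m))
      (pow_ne_zero _ hp.ne_zero) ?_
    rintro x ⟨hx, hxm⟩ y ⟨hy, hym⟩ hxy hdvd
    obtain ⟨N, U, hU, h⟩ := hS x hx y hy hxy
    rw [hxm, hym, ← mul_sub, ← Int.cast_sub] at h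
    have hNm : N ≤ m := by
      rw [← hmono.le_iff_le]
      have h1 := congrArg V.valuation h
      rw [map_mul, map_pow, valuation_pow_mul_unit hV N hU] at h1
      exact h1 ▸ mul_le_of_le_one_right' (hle _)
    obtain ⟨e, rfl⟩ := Nat.exists_eq_add_of_le hNm
    rw [pow_add, mul_assoc, mul_right_inj' (pow_ne_zero _ hb0.ne')] at h
    have h2 : (q.num : ℝ) ^ e * ((z x - z y : ℤ) : ℝ) ^ r = (q.den : ℝ) ^ e * (U : ℝ) ^ r := by
      rw [← h, mul_pow, ← pow_mul, mul_comm e r, pow_mul, hq, ← mul_assoc, ← mul_pow]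
      congr 2
      exact_mod_cast (Rat.den_mul_eq_num q).symm
    have h3 : q.num ^ e * (z x - z y) ^ r = (q.den : ℤ) ^ e * U ^ r := by exact_mod_cast h2
    have h4 : ((p ^ (q.den ^ (N + e)) : ℕ) : ℤ) ∣ (q.den : ℤ) ^ e * U ^ r :=
      h3 ▸ (hdvd.trans (dvd_pow_self _ hr.ne')).mul_left _
    have hcop : IsCoprime ((p ^ (q.den ^ (N + e)) : ℕ) : ℤ) (U ^ r) := by
      rw [Nat.cast_pow]
      exact ((Nat.prime_iff_prime_int.mp hp).coprime_iff_not_dvd.mpr hU).pow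
    have h5 := hcop.dvd_of_dvd_mul_right h4
    have h6 : p ^ (q.den ^ (N + e)) ∣ q.den ^ e := by exact_mod_cast h5
    have h7 := Nat.le_of_dvd (pow_pos q.den_pos _) h6
    have h8 : q.den ^ e ≤ q.den ^ (N + e) := Nat.pow_le_pow_right q.den_pos (by omega)
    exact absurd (Nat.lt_pow_self (n := q.den ^ (N + e)) hp.one_lt) (by omega)
  by_contra hinf
  obtain ⟨j, hj⟩ := Set.Infinite.nonempty hinf
  -- The exponents are now unbounded. The valuation forces `N = n i`, so `z j` is `b ^ (n i - n j)`
  -- times a nonzero integer. Choosing `b ^ d > |z j|` contradicts this in ordinary absolute value.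
  obtain ⟨d, hd⟩ := pow_unbounded_of_one_lt |(z j : ℝ)| hb
  have hex : ∃ i ∈ S, n j + d < n i := by
    by_contra! hcon
    refine hinf (((Set.finite_Iic (n j + d)).biUnion fun m _ => hlevel m).subset fun x hx => ?_)
    exact Set.mem_biUnion (hcon x hx) ⟨hx, rfl⟩
  obtain ⟨i, hi, hij⟩ := hex
  obtain ⟨N, U, hU, h⟩ := hS i hi j hj (by rintro rfl; omega)
  have hlt : V.valuation b ^ n j < V.valuation b ^ n i := hmono (by omega)
  have hN := valuation_pow_of_sub_eq hV (hz i hi) (hz j hj) hU h hlt.ne'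
  rw [max_eq_left hlt.le] at hN
  obtain rfl := hmono.injective hN
  obtain ⟨e, he⟩ := Nat.exists_eq_add_of_lt hij
  rw [he, show n j + d + e + 1 = n j + (d + e + 1) by ring, pow_add _ (n j), mul_assoc, mul_assoc,
    ← mul_sub, ← sub_eq_zero, ← mul_sub] at h
  have h1 : (z j : ℝ) = b ^ (d + e + 1) * ((z i - U : ℤ) : ℝ) := by
    have := (mul_eq_zero.mp h).resolve_left (pow_ne_zero _ hb0.ne')
    push_cast
    linear_combination -this
  have hne : z i - U ≠ 0 := by
    intro h0
    rw [h0, Int.cast_zero, mul_zero] at h1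
    apply hz j hj
    rw [show z j = 0 by exact_mod_cast h1]
    exact dvd_zero _
  have h2 : (1 : ℝ) ≤ |((z i - U : ℤ) : ℝ)| := by
    exact_mod_cast Int.one_le_abs hne
  have h3 : |(z j : ℝ)| = b ^ (d + e + 1) * |((z i - U : ℤ) : ℝ)| := by
    rw [h1, abs_mul, abs_of_pos (pow_pos hb0 _)]
  have h4 : b ^ d ≤ b ^ (d + e + 1) := pow_le_pow_right₀ hb.le (by omega)
  nlinarith [pow_pos hb0 (d + e + 1)]

-- Applied to the coordinates of the frequencies, scaled by `p`.
open Polynomial in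
theorem rational_of_infinite {p : ℕ} (hp : p.Prime) {b κ : ℝ} (hb : 1 < b) {α : Type*} {S : Set α}
    (hinf : S.Infinite) {f g : α → ℝ}
    (hS : ∀ x ∈ S, ∀ y ∈ S, x ≠ y → ∃ n : ℕ, ∃ u v : ℤ, ¬ (p : ℤ) ∣ u ∧
      f x - f y = b ^ n * u ∧ g x - g y = b ^ n * (n * κ * u + v)) :
    (∃ r : ℕ, 0 < r ∧ ∃ q : ℚ, b ^ r = q ∧ (p : ℤ) ∣ q.num) ∧ ∃ q : ℚ, κ = q := by
  have hb0 : 0 < b := zero_lt_one.trans hb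
  obtain ⟨o, ho⟩ := hinf.nonempty
  have hT : (S \ {o}).Infinite := hinf.sdiff (Set.finite_singleton o)
  have hex : ∀ x ∈ S \ {o}, ∃ n : ℕ, ∃ u v : ℤ, ¬ (p : ℤ) ∣ u ∧
      f x - f o = b ^ n * u ∧ g x - g o = b ^ n * (n * κ * u + v) :=
    fun x hx => hS x hx.1 o ho hx.2
  choose! n u v hu hf hg using hex
  have hpair : ∀ x ∈ S \ {o}, ∀ y ∈ S \ {o}, x ≠ y → ∃ N : ℕ, ∃ U W : ℤ, ¬ (p : ℤ) ∣ U ∧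
      b ^ n x * (u x : ℝ) - b ^ n y * u y = b ^ N * U ∧
      b ^ n x * (n x * κ * u x + v x) - b ^ n y * (n y * κ * u y + v y) =
        b ^ N * (N * κ * U + W) := by
    intro x hx y hy hxy
    obtain ⟨N, U, W, hU, h1, h2⟩ := hS x hx.1 y hy.1 hxy
    refine ⟨N, U, W, hU, ?_, ?_⟩
    · rw [← h1, ← hf x hx, ← hf y hy]
      ring
    · rw [← h2, ← hg x hx, ← hg y hy]
      ring
  obtain ⟨V, hle, hV⟩ := exists_valuationSubring_int p hp
  have hnd : ∃ x ∈ S \ {o}, ∃ y ∈ S \ {o}, ∃ N : ℕ, ∃ U W : ℤ, ¬ (p : ℤ) ∣ U ∧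
      b ^ n x * (u x : ℝ) - b ^ n y * u y = b ^ N * U ∧
      b ^ n x * (n x * κ * u x + v x) - b ^ n y * (n y * κ * u y + v y) =
        b ^ N * (N * κ * U + W) ∧ ¬ (n x = n y ∧ n x = N) := by
    -- If all exponents always agreed, the integers `u x` would be distinct modulo `p`.
    by_contra! hcon
    refine hT (finite_of_injOn_intCast (f := u) hp.ne_zero fun x hx y hy hxy => ?_)
    obtain ⟨N, U, W, hU, h1, h2⟩ := hpair x hx y hy hxy
    obtain ⟨h3, h4⟩ := hcon x hx y hy N U W hU h1 h2
    rw [← h3, h4, ← mul_sub, mul_right_inj' (pow_ne_zero _ hb0.ne')] at h1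
    rwa [show u x - u y = U by exact_mod_cast h1]
  obtain ⟨x, hx, y, hy, N, U, W, hU, h1, h2, hne⟩ := hnd
  have hv0 : 0 < V.valuation b := (Valuation.pos_iff _).mpr hb0.ne'
  have hv1 : V.valuation b ≠ 1 := by
    intro hv
    have : Fact p.Prime := ⟨hp⟩
    refine hT (finite_of_valuation_eq_one hp hV hv (f := fun x => f x - f o) hf ?_
      (P := C (u x) * X ^ n x - C (u y) * X ^ n y - C U * X ^ N) ?_ ?_)
    · intro x hx y hy hxy
      obtain ⟨N, U, W, hU, h1, -⟩ := hpair x hx y hy hxy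
      rw [hf x hx, hf y hy, h1, valuation_pow_mul_unit hV N hU, hv, one_pow]
    · have hz : ∀ w : ℤ, ¬ (p : ℤ) ∣ w → (w : ZMod p) ≠ 0 := fun w hw h0 =>
        hw ((ZMod.intCast_zmod_eq_zero_iff_dvd w p).mp h0)
      simpa using trinomial_ne_zero (hz _ (hu x hx)) (hz _ (hu y hy)) (hz _ hU) hne
    · simp
      linear_combination h1
  have hinj := pow_right_injective₀ hv0 hv1
  have hnz : ∀ w : ℤ, ¬ (p : ℤ) ∣ w → w ≠ 0 := by
    rintro w hw rfl
    exact hw (dvd_zero _)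
  have key : (∃ r : ℕ, 0 < r ∧ ∃ q : ℚ, b ^ r = q) ∧ ∃ q : ℚ, κ = q := by
    by_cases hxy : n x = n y
    · have hN : n x ≠ N := fun h => hne ⟨hxy, h⟩
      refine exists_rat_of_ne hb0.ne' hN (x₁ := u x - u y) (y₁ := v x - v y) (hnz U hU) ?_ ?_ (y₂ := W)
      · rw [← h1, ← hxy]
        push_cast
        ring
      · rw [← h2, ← hxy]
        push_cast
        ring
    -- The dominant term on the left has the valuation of the right side, so `N` is `n x` or `n y`.
    -- Merging those two terms leaves a two-term relation.
    · have hmax := valuation_pow_of_sub_eq hV (hu x hx) (hu y hy) hU h1 (hinj.ne hxy)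
      rcases max_choice (V.valuation b ^ n x) (V.valuation b ^ n y) with hm | hm
      · obtain rfl := hinj (hmax.trans hm)
        refine exists_rat_of_ne hb0.ne' hxy (x₁ := u x - U) (y₁ := v x - W) (hnz _ (hu y hy))
          ?_ ?_ (y₂ := v y)
        · push_cast
          linear_combination h1
        · push_cast
          linear_combination h2
      · obtain rfl := hinj (hmax.trans hm)
        refine exists_rat_of_ne hb0.ne' (Ne.symm hxy) (x₁ := u y + U) (y₁ := v y + W)
          (hnz _ (hu x hx)) ?_ ?_ (y₂ := v x)
        · push_cast
          linear_combination -h1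
        · push_cast
          linear_combination -h2
  obtain ⟨⟨r, hr, q, hq⟩, hκ⟩ := key
  refine ⟨⟨r, hr, q, hq, ?_⟩, hκ⟩
  have hlt : V.valuation b < 1 := by
    by_contra! hge
    refine hT (finite_of_one_lt_valuation hp hb hle hV (lt_of_le_of_ne hge (Ne.symm hv1)) hr hq
      (n := n) (z := u) hu fun x hx y hy hxy => ?_)
    obtain ⟨N, U, W, hU, h1, -⟩ := hpair x hx y hy hxy
    exact ⟨N, U, hU, h1⟩
  by_contra hnum
  have h3 : b ^ r * (q.den : ℤ) = (q.num : ℤ) := by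
    rw [hq]
    exact_mod_cast Rat.mul_den_eq_num q
  have h4 := congrArg V.valuation h3
  rw [map_mul, map_pow, (hV _).mpr hnum] at h4
  refine absurd h4 (ne_of_lt ?_)
  exact (mul_le_of_le_one_right' (hle _)).trans_lt (pow_lt_one₀ zero_le hlt hr.ne')

/-! ### Infinite orthogonal sets of exponentials -/

theorem fourierMeasure_neg (μ : Measure Plane) (ξ : Plane) :
    fourierMeasure μ (-ξ) = (starRingEnd ℂ) (fourierMeasure μ ξ) := by
  rw [fourierMeasure_eq_charFun, fourierMeasure_eq_charFun, smul_neg, charFun_neg]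

/-- A sequence of frequencies whose forward differences are zeros of the Fourier transform gives
an infinite orthogonal set of exponentials. -/
theorem hasInfiniteOrthogonalExponentials_of_seq {μ : Measure Plane} [IsProbabilityMeasure μ]
    {F : ℕ → Plane} (hF : ∀ l k, l < k → fourierMeasure μ (F k - F l) = 0) :
    HasInfiniteOrthogonalExponentials μ := by
  have hF' : ∀ l k, l ≠ k → fourierMeasure μ (F k - F l) = 0 := by
    intro l k hlk
    rcases hlk.lt_or_gt with h | h
    · exact hF l k h
    · rw [← neg_sub, fourierMeasure_neg, hF k l h, map_zero]
  rw [hasInfiniteOrthogonalExponentials_iff]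
  refine ⟨Set.range F, Set.infinite_range_of_injective fun l k hlk => ?_, ?_⟩
  · by_contra hne
    have h := hF' l k hne
    rw [hlk, sub_self, fourierMeasure_zero] at h
    exact one_ne_zero h
  · rintro _ ⟨l, rfl⟩ _ ⟨k, rfl⟩ hlk
    exact hF' l k fun h => hlk (h ▸ rfl)

/-- Changing `j` by a multiple of `p` moves `j a / p` by an integer vector, so `j` may be any
integer prime to `p`. -/
theorem mem_iUnion_translates_iff {p : ℕ} (hp : p.Prime) {a : Fin 2 → ℤ} {ζ : Plane} :
    (ζ ∈ ⋃ j ∈ Finset.Icc 1 (p - 1),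
        {ξ : Plane | ∃ k : Fin 2 → ℤ, ∀ i, ξ i = (j : ℝ) * (a i : ℝ) / (p : ℝ) + (k i : ℝ)}) ↔
      ∃ j : ℤ, ¬ (p : ℤ) ∣ j ∧ ∃ k : Fin 2 → ℤ, ∀ i, (p : ℝ) * ζ i = j * a i + p * k i := by
  have hp0 : (p : ℝ) ≠ 0 := by exact_mod_cast hp.ne_zero
  have hpz : (0 : ℤ) < p := by exact_mod_cast hp.pos
  simp only [Set.mem_iUnion, Set.mem_ofPred_eq, Finset.mem_Icc, exists_prop]
  constructor
  · rintro ⟨j, ⟨h1, h2⟩, k, hk⟩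
    refine ⟨j, fun h => ?_, k, fun i => ?_⟩
    · have := Nat.le_of_dvd h1 (Int.natCast_dvd_natCast.mp h)
      have := hp.pos
      omega
    · rw [hk i]
      push_cast
      field_simp
  · rintro ⟨j, hj, k, hk⟩
    have h0 := Int.emod_nonneg j hpz.ne'
    have h1 := Int.emod_lt_of_pos j hpz
    have h2 : j % p ≠ 0 := fun h => hj (Int.dvd_of_emod_eq_zero h)
    obtain ⟨m, hm⟩ := Int.eq_ofNat_of_zero_le h0
    refine ⟨m, ⟨by omega, by omega⟩, fun i => j / p * a i + k i, fun i => ?_⟩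
    have h3 : (j : ℝ) = m + p * ((j / p : ℤ) : ℝ) := by
      exact_mod_cast (hm ▸ Int.emod_add_mul_ediv j p).symm
    have h4 := hk i
    rw [h3] at h4
    push_cast
    field_simp
    linear_combination h4

theorem HasInfiniteOrthogonalExponentials.rational {p : ℕ} (hp : p.Prime) {ρ c : ℝ} (hρ0 : 0 < ρ)
    (hρ1 : ρ < 1) {D : Finset (Fin 2 → ℤ)} {a : Fin 2 → ℤ} (ha : ¬ (p : ℤ) ∣ a 0)
    (hZ : digitZeroSet D =
      ⋃ j ∈ Finset.Icc 1 (p - 1),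
        {ξ : Plane | ∃ k : Fin 2 → ℤ, ∀ i, ξ i = (j : ℝ) * (a i : ℝ) / (p : ℝ) + (k i : ℝ)})
    {μ : Measure Plane} [IsProbabilityMeasure μ]
    (hμ : IsSelfAffineMeasure !![ρ⁻¹, c; 0, ρ⁻¹] D μ)
    (h : HasInfiniteOrthogonalExponentials μ) :
    (∃ r : ℕ, 0 < r ∧ ∃ q : ℚ, ρ⁻¹ ^ r = q ∧ (p : ℤ) ∣ q.num) ∧ ∃ q : ℚ, c * ρ = q := by
  rw [hasInfiniteOrthogonalExponentials_iff] at h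
  obtain ⟨Λ, hinf, hΛ⟩ := h
  refine rational_of_infinite hp ((one_lt_inv₀ hρ0).mpr hρ1) hinf (f := fun x => p * x 0)
    (g := fun x => p * x 1) fun x hx y hy hxy => ?_
  obtain ⟨n, ζ, hζ, hn⟩ := hμ.exists_mem_digitZeroSet hρ0 hρ1 (hΛ hy hx (Ne.symm hxy))
  rw [hZ, mem_iUnion_translates_iff hp] at hζ
  obtain ⟨j, hj, k, hk⟩ := hζ
  refine ⟨n, j * a 0 + p * k 0, j * a 1 + p * k 1, ?_, ?_, ?_⟩
  · rw [dvd_add_left (dvd_mul_right _ _)]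
    exact (Nat.prime_iff_prime_int.mp hp).not_dvd_mul hj ha
  · have h0 := congrArg (fun v : Plane => v 0) hn
    simp only [PiLp.sub_apply, shear_apply_zero, zpow_natCast] at h0
    push_cast
    rw [← mul_sub, h0, ← hk 0]
    ring
  · have h1 := congrArg (fun v : Plane => v 1) hn
    simp only [PiLp.sub_apply, shear_apply_one, zpow_natCast, Int.cast_natCast] at h1
    push_cast
    rw [← mul_sub, h1, ← hk 0, ← hk 1]
    ring

theorem hasInfiniteOrthogonalExponentials_of_rational {p : ℕ} (hp : p.Prime) {ρ c : ℝ}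
    (hρ0 : 0 < ρ) {D : Finset (Fin 2 → ℤ)} {a : Fin 2 → ℤ}
    (hZ : digitZeroSet D =
      ⋃ j ∈ Finset.Icc 1 (p - 1),
        {ξ : Plane | ∃ k : Fin 2 → ℤ, ∀ i, ξ i = (j : ℝ) * (a i : ℝ) / (p : ℝ) + (k i : ℝ)})
    {μ : Measure Plane} [IsProbabilityMeasure μ]
    (hμ : IsSelfAffineMeasure !![ρ⁻¹, c; 0, ρ⁻¹] D μ) {s t r : ℕ} (hs : 0 < s) (hr : 0 < r)
    (hst : Nat.Coprime s t) (hpt : p ∣ t) (hb : ρ⁻¹ ^ r = (t : ℝ) / s) {κ : ℚ}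
    (hκ : c * ρ = κ) : HasInfiniteOrthogonalExponentials μ := by
  have hb0 : ρ⁻¹ ≠ 0 := inv_ne_zero hρ0.ne'
  have hp0 : (p : ℝ) ≠ 0 := by exact_mod_cast hp.ne_zero
  have hs0 : (s : ℝ) ≠ 0 := by exact_mod_cast hs.ne'
  have hps : ¬ (p : ℤ) ∣ s := fun h =>
    hp.one_lt.ne' (Nat.eq_one_of_dvd_coprimes hst (Int.natCast_dvd_natCast.mp h) hpt)
  have hpow : ∀ n : ℕ, (ρ⁻¹) ^ (r * κ.den * n) * (s : ℝ) ^ (κ.den * n) = (t : ℝ) ^ (κ.den * n) := by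
    intro n
    rw [mul_assoc, pow_mul, hb, ← mul_pow, div_mul_cancel₀ _ hs0]
  have hden : (κ.den : ℝ) * (κ : ℝ) = κ.num := by exact_mod_cast Rat.den_mul_eq_num κ
  -- The powers of `s` clear the denominators of `b ^ r = t / s`, and `κ.den` in the exponent of
  -- `Mᵀ` makes the shear term `n * κ` an integer. The shift to `n + 1` below keeps that exponent
  -- positive, as zeros of `μ̂` require.
  let A : ℕ → Plane := fun n =>
    WithLp.toLp 2 ![(s : ℝ) ^ (κ.den * n) * a 0 / p, (s : ℝ) ^ (κ.den * n) * a 1 / p]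
  refine hasInfiniteOrthogonalExponentials_of_seq
    (F := fun n => shear ρ⁻¹ (c * ρ) ((r * κ.den * (n + 1) : ℕ) : ℤ) (A (n + 1))) fun l k hlk => ?_
  obtain ⟨m, rfl⟩ := Nat.exists_eq_add_of_lt hlk
  obtain ⟨N, hN⟩ : ∃ N, r * κ.den * (l + 1) = N + 1 :=
    Nat.exists_eq_succ_of_ne_zero (by have := κ.den_pos; positivity)
  obtain ⟨w, hw⟩ : p ∣ t ^ (κ.den * (m + 1)) :=
    hpt.trans (dvd_pow_self t (by have := κ.den_pos; positivity))
  have hw' : (t : ℝ) ^ (κ.den * (m + 1)) = p * w := by exact_mod_cast hw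
  set ζ : Plane := shear ρ⁻¹ (c * ρ) ((r * κ.den * (m + 1) : ℕ) : ℤ) (A (l + m + 1 + 1)) -
    A (l + 1) with hζ
  have hsub : shear ρ⁻¹ (c * ρ) ((r * κ.den * (l + m + 1 + 1) : ℕ) : ℤ) (A (l + m + 1 + 1)) -
      shear ρ⁻¹ (c * ρ) ((r * κ.den * (l + 1) : ℕ) : ℤ) (A (l + 1)) =
      shear ρ⁻¹ (c * ρ) ((N + 1 : ℕ) : ℤ) ζ := by
    rw [← hN, show r * κ.den * (l + m + 1 + 1) = r * κ.den * (l + 1) + r * κ.den * (m + 1) by ring,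
      Nat.cast_add, shear_add hb0, hζ]
    apply Plane.ext
    · simp only [PiLp.sub_apply, shear_apply_zero]
      ring
    · simp only [PiLp.sub_apply, shear_apply_zero, shear_apply_one]
      ring
  rw [hsub]
  refine hμ.fourierMeasure_eq_zero hρ0.ne' ?_ N
  rw [hZ, mem_iUnion_translates_iff hp]
  have hsplit : (ρ⁻¹) ^ (r * κ.den * (m + 1)) * (s : ℝ) ^ (κ.den * (l + m + 1 + 1)) =
      p * w * (s : ℝ) ^ (κ.den * (l + 1)) := by
    rw [← hw', ← hpow]
    ring
  -- In `ζ` the sheared term carries a positive power of `t`, which absorbs the denominator `p`.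
  -- Modulo `ℤ²` only `-s ^ (κ.den * (l + 1)) a / p` remains, and `p ∤ s`.
  refine ⟨-(s : ℤ) ^ (κ.den * (l + 1)), ?_, fun i => (w : ℤ) * (s : ℤ) ^ (κ.den * (l + 1)) *
    (![a 0, r * (m + 1) * κ.num * a 0 + a 1] : Fin 2 → ℤ) i, fun i => ?_⟩
  · rw [dvd_neg]
    exact fun h => hps ((Nat.prime_iff_prime_int.mp hp).dvd_of_dvd_pow h)
  · fin_cases i
    · simp only [hζ, A, Fin.zero_eta, PiLp.sub_apply, shear_apply_zero, Matrix.cons_val_zero, zpow_natCast]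
      push_cast
      field_simp
      rw [one_div]
      linear_combination (a 0 : ℝ) * hsplit
    · simp only [hζ, A, Fin.mk_one, PiLp.sub_apply, shear_apply_one, Matrix.cons_val_zero, Matrix.cons_val_one, zpow_natCast, hκ]
      push_cast
      rw [mul_sub, mul_div_cancel₀ _ hp0]
      have h1 : (p : ℝ) * ((ρ⁻¹) ^ (r * κ.den * (m + 1)) * (((r : ℝ) * κ.den * (m + 1)) * κ *
          ((s : ℝ) ^ (κ.den * (l + m + 1 + 1)) * a 0 / p) +
          (s : ℝ) ^ (κ.den * (l + m + 1 + 1)) * a 1 / p)) =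
          ((ρ⁻¹) ^ (r * κ.den * (m + 1)) * (s : ℝ) ^ (κ.den * (l + m + 1 + 1))) *
            (r * (m + 1) * (κ.den * κ) * a 0 + a 1) := by
        field_simp
      rw [h1, hsplit, hden]
      ring

/-! ### Existence, uniqueness and the arithmetic criterion -/

theorem theorem1p7 (p : ℕ) (hp : p.Prime) (ρ c : ℝ) (hρ0 : 0 < ρ) (hρ1 : ρ < 1)
    (D : Finset (Fin 2 → ℤ)) (hD : D.card = p)
    (a : Fin 2 → ℤ) (ha : ∀ i, 1 ≤ a i ∧ a i ≤ (p : ℤ) - 1)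
    (hZ : digitZeroSet D =
      ⋃ j ∈ Finset.Icc 1 (p - 1),
        {ξ : Plane | ∃ k : Fin 2 → ℤ, ∀ i, ξ i = (j : ℝ) * (a i : ℝ) / (p : ℝ) + (k i : ℝ)}) :
    (∃! μ : ProbabilityMeasure Plane,
        IsSelfAffineMeasure !![ρ⁻¹, c; 0, ρ⁻¹] D (μ : Measure Plane)) ∧
      ∀ μ : ProbabilityMeasure Plane,
        IsSelfAffineMeasure !![ρ⁻¹, c; 0, ρ⁻¹] D (μ : Measure Plane) →
        (HasInfiniteOrthogonalExponentials (μ : Measure Plane) ↔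
          ∃ s t r : ℕ, 0 < s ∧ 0 < t ∧ 0 < r ∧ Nat.gcd s t = 1 ∧ p ∣ t ∧
            ρ⁻¹ = ((t : ℝ) / (s : ℝ)) ^ ((1 : ℝ) / (r : ℝ)) ∧
            ∃ κ : ℚ, c = (κ : ℝ) * ρ⁻¹) := by
  have hDne : D.Nonempty := Finset.card_pos.mp (hD ▸ hp.pos)
  have hb0 : 0 < ρ⁻¹ := inv_pos.mpr hρ0
  refine ⟨?_, fun μ hμ => ⟨fun h => ?_, ?_⟩⟩
  · obtain ⟨μ, hμ⟩ := exists_isSelfAffineMeasure hρ0 hρ1 c hDne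
    exact ⟨μ, hμ, fun ν hν => Subtype.ext (IsSelfAffineMeasure.unique (μ := (ν : Measure Plane))
      (ν := (μ : Measure Plane)) hρ0 hρ1 hDne hν hμ)⟩
  · have ha0 : ¬ (p : ℤ) ∣ a 0 := fun hdvd => by
      have := Int.le_of_dvd (by linarith [(ha 0).1]) hdvd
      linarith [(ha 0).2]
    obtain ⟨⟨r, hr, q, hq, hpq⟩, κ, hκ⟩ := h.rational hp hρ0 hρ1 ha0 hZ hμ
    have hq0 : 0 < q := by
      have : (0 : ℝ) < q := hq ▸ pow_pos hb0 r
      exact_mod_cast this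
    have hnum : 0 < q.num := Rat.num_pos.mpr hq0
    refine ⟨q.den, q.num.natAbs, r, q.den_pos, Int.natAbs_pos.mpr hnum.ne', hr, q.reduced.symm,
      Int.natCast_dvd.mp hpq, ?_, κ, ?_⟩
    · have h1 : ((q.num.natAbs : ℕ) : ℝ) / (q.den : ℝ) = ρ⁻¹ ^ r := by
        rw [hq, Nat.cast_natAbs, abs_of_pos hnum]
        exact_mod_cast Rat.num_div_den q
      rw [h1, one_div, Real.pow_rpow_inv_natCast hb0.le hr.ne']
    · rw [← hκ, mul_assoc, mul_inv_cancel₀ hρ0.ne', mul_one]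
  · rintro ⟨s, t, r, hs, -, hr, hst, hpt, hb, κ, hκ⟩
    refine hasInfiniteOrthogonalExponentials_of_rational hp hρ0 hZ hμ hs hr hst hpt ?_ (κ := κ) ?_
    · rw [hb, one_div, Real.rpow_inv_natCast_pow (by positivity) hr.ne']
    · rw [hκ, mul_assoc, inv_mul_cancel₀ hρ0.ne', mul_one]
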